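/- Let $(a(n))_{n\ge 0}$ be a sequence of real numbers that satisfies a linear recurrence \[ a(n+d) = s_1 a(n+d-1) + \dots + s_{d-1}a(n+1) + s_d a(n), \qquad n\ge 0, \] with constant coefficients $s_1,\dots,s_d\in\mathbb{R}$, and suppose that $a(n)\neq 0$ for infinitely many $n$ (if $s_d\neq 0$, this just says that the sequence is not identically zero). Let $\alpha_1,\dots,\alpha_s$ be the distinct nonzero complex roots of the characteristic polynomial $z^d - s_1 z^{d-1}-\dots-s_{d-1}z-s_d$, and write, for all sufficiently large $n$ (for all $n\ge 0$ if $s_d\ne 0$), \[ a(n) = C_1(n)\alpha_1^n + \dots + C_s(n)\alpha_s^n \] with the uniquely determined polynomials $C_1,\dots,C_s\in\mathbb{C}[n]$. The characteristic roots of $(a(n))$ are the $\alpha_k$ with $C_k\neq 0$; the dominating characteristic roots of $(a(n))$ are the characteristic roots of $(a(n))$ of maximal modulus. If $(a(n))$ has at most four (distinct) dominating characteristic roots, and none of them is a positive real number, then $a(n)>0$ for infinitely many $n$ and $a(n)<0$ for infinitely many $n$. -/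

import Mathlib

open Polynomial Filter

noncomputable section

namespace RecurrenceSequence

/-- The set of distinct nonzero complex roots of the characteristic polynomial of `E`. -/
def nonzeroRoots (E : LinearRecurrence ℝ) : Finset ℂ :=
  (E.charPoly.aroots ℂ).toFinset.erase 0

/-- `C` gives the coefficients of a representation of `a` as a generalized power sum
`a n = ∑ α, C_α(n) α ^ n` over the roots `α` of the characteristic polynomial of `E`, with
polynomials `C_α`. A root `0` (present only if the last coefficient of the recurrence is `0`)
affects only finitely many terms of a solution; therefore it is left out, and the identity is
required for all large `n`. Without a root `0`, the identity for all large `n` and the identity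
for all `n` are equivalent for solutions of `E`. -/
def IsPowerSumRepr (E : LinearRecurrence ℝ) (a : ℕ → ℝ) (C : ℂ → ℂ[X]) : Prop :=
  ∀ᶠ n : ℕ in atTop, (a n : ℂ) = ∑ α ∈ nonzeroRoots E, (C α).eval (n : ℂ) * α ^ n

/-- The (nonzero) characteristic roots of the solution `a` of `E`: the roots that occur with a
nonzero coefficient in the representation of `a` as a generalized power sum. -/
def charRoots (E : LinearRecurrence ℝ) (a : ℕ → ℝ) : Set ℂ :=
  {α | α ∈ nonzeroRoots E ∧ ∃ C : ℂ → ℂ[X], IsPowerSumRepr E a C ∧ C α ≠ 0}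

/-- The dominating characteristic roots: the characteristic roots of maximal modulus. -/
def dominatingRoots (E : LinearRecurrence ℝ) (a : ℕ → ℝ) : Set ℂ :=
  {α | α ∈ charRoots E a ∧ ∀ β ∈ charRoots E a, ‖β‖ ≤ ‖α‖}

end RecurrenceSequence

end

/-!
The characteristic polynomial evaluated at the shift operator annihilates a solution `a`, so `a` is
a sum of generalized eigenvectors of the shift; at an eigenvalue `α ≠ 0` these are the sequences
`P(n) α ^ n` with a polynomial `P`, and at `0` they vanish eventually.

Let `ρ` be the modulus of the dominating roots and `D` the largest degree of their coefficients. For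
every `z` of modulus `ρ`, the Cesàro means of `a(n) / (n ^ D z ^ n)` converge to the coefficient of
`n ^ D` in front of `z ^ n`. If `a` is eventually nonnegative, then `a(n) / (n ^ D ρ ^ n)` is
eventually equal to `|a(n) / (n ^ D z ^ n)|` for each such `z`. Hence if the limit at `ρ` were `0`,
the limits at all `z` would be `0`, contradicting the choice of `D`; so `ρ` is a dominating root.
Applying this to `a` and `-a` gives both signs.
-/

open scoped Topology ComplexOrder fwdDiff

namespace RecurrenceSequence

/-! ### Sequences annihilated by a polynomial in the shift -/

section Shift

/-- The shift `f ↦ (n ↦ f (n + 1))` on sequences, as a linear operator: a sequence satisfies a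
linear recurrence if and only if the characteristic polynomial at the shift annihilates it. -/
def shift (R : Type*) [CommSemiring R] : Module.End R (ℕ → R) :=
  LinearMap.funLeft R R (· + 1)

/-- The generalized power sum `∑ α ∈ S, P_α(n) α ^ n` with bases `α ∈ S` and polynomial
coefficients `P_α`. The values of `P` outside `S` are irrelevant. -/
def powerSum {R : Type*} [CommSemiring R] (S : Finset R) (P : R → R[X]) (n : ℕ) : R :=
  ∑ α ∈ S, (P α).eval (n : R) * α ^ n

theorem shift_apply {R : Type*} [CommSemiring R] (f : ℕ → R) (n : ℕ) :
    shift R f n = f (n + 1) :=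
  rfl

theorem shift_pow_apply {R : Type*} [CommSemiring R] (f : ℕ → R) (k n : ℕ) :
    (shift R ^ k) f n = f (n + k) := by
  induction k generalizing n with
  | zero => rfl
  | succ k ih => rw [pow_succ', Module.End.mul_apply, shift_apply, ih, add_right_comm, add_assoc]

theorem aeval_shift_charPoly_algebraMap {R A : Type*} [CommRing R] [CommRing A] [Algebra R A]
    {E : LinearRecurrence R} {a : ℕ → R} (ha : E.IsSolution a) :
    aeval (shift A) E.charPoly (fun n ↦ algebraMap R A (a n)) = 0 := by
  ext n
  simp [LinearRecurrence.charPoly, aeval_monomial, shift_pow_apply, ha n, Algebra.smul_def]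

theorem ker_aeval_prod_eq_iSup {R M ι : Type*} [CommRing R] [AddCommGroup M] [Module R M]
    (T : Module.End R M) {S : Finset ι} {q : ι → R[X]}
    (hq : (S : Set ι).Pairwise (Function.onFun IsCoprime q)) :
    LinearMap.ker (aeval T (∏ i ∈ S, q i)) = ⨆ i ∈ S, LinearMap.ker (aeval T (q i)) := by
  classical
  induction S using Finset.induction_on with
  | empty => simp [Module.End.one_eq_id]
  | insert j S hj ih =>
    rw [Finset.coe_insert] at hq
    have hcoprime : IsCoprime (q j) (∏ i ∈ S, q i) := IsCoprime.prod_right fun i hi ↦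
      hq (Set.mem_insert j S) (Set.mem_insert_of_mem j hi) (ne_of_mem_of_not_mem hi hj).symm
    rw [Finset.prod_insert hj, Finset.iSup_insert, ← ih (hq.mono (Set.subset_insert j S)),
      sup_ker_aeval_eq_ker_aeval_mul_of_coprime T hcoprime]

theorem mem_iSup_maxGenEigenspace_of_aeval_eq_zero {K V : Type*} [Field K] [DecidableEq K]
    [AddCommGroup V] [Module K V] {T : Module.End K V} {p : K[X]} (hp : p.Splits) (hp₀ : p ≠ 0)
    {v : V} (hv : aeval T p v = 0) : v ∈ ⨆ α ∈ p.roots.toFinset, T.maxGenEigenspace α := by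
  have hfactor : aeval T (∏ α ∈ p.roots.toFinset, (X - C α) ^ p.rootMultiplicity α) v = 0 := by
    rw [hp.eq_prod_roots, prod_multiset_root_eq_finset_root, map_mul, aeval_C,
      Module.End.mul_apply, Module.algebraMap_end_apply] at hv
    exact (smul_eq_zero.mp hv).resolve_left (leadingCoeff_ne_zero.mpr hp₀)
  have hcoprime : (p.roots.toFinset : Set K).Pairwise
      (Function.onFun IsCoprime fun α ↦ (X - C α) ^ p.rootMultiplicity α) :=
    fun _ _ _ _ h ↦ (pairwise_coprime_X_sub_C Function.injective_id h).pow
  have hker_le (α : K) (m : ℕ) : LinearMap.ker (aeval T ((X - C α) ^ m)) ≤ T.maxGenEigenspace α :=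
    fun u hu ↦ (T.mem_maxGenEigenspace α u).mpr
      ⟨m, by simpa [Algebra.algebraMap_eq_smul_one] using hu⟩
  rw [← LinearMap.mem_ker, ker_aeval_prod_eq_iSup T hcoprime] at hfactor
  have hmono := iSup₂_mono fun α (_ : α ∈ p.roots.toFinset) ↦ hker_le α (p.rootMultiplicity α)
  exact hmono hfactor

theorem shift_sub_smul_one_pow_apply {R : Type*} [CommRing R] (α : R) (g : ℕ → R) (k n : ℕ) :
    ((shift R - α • 1) ^ k) (fun n ↦ α ^ n * g n) n = α ^ (n + k) * ((Δ_[1])^[k] g) n := by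
  induction k generalizing n with
  | zero => rfl
  | succ k ih =>
    rw [pow_succ', Module.End.mul_apply, LinearMap.sub_apply, LinearMap.smul_apply,
      Module.End.one_apply, Pi.sub_apply, Pi.smul_apply, shift_apply, ih, ih, smul_eq_mul,
      Function.iterate_succ_apply', fwdDiff]
    ring

theorem exists_eval_natCast_eq_of_fwdDiff_iter_eq_zero {K : Type*} [Field K] [CharZero K]
    {g : ℕ → K} {k : ℕ} (hg : (Δ_[1])^[k] g = 0) : ∃ P : K[X], ∀ n : ℕ, g n = P.eval (n : K) := by
  refine ⟨∑ j ∈ Finset.range k, C (((Δ_[1])^[j] g) 0 / j.factorial) * descPochhammer K j,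
    fun n ↦ ?_⟩
  have hvanish (j : ℕ) (hj : k ≤ j) : (Δ_[1])^[j] g = 0 := by
    rw [← Nat.sub_add_cancel hj, Function.iterate_add_apply, hg]
    exact Function.iterate_fixed (fwdDiff_const 1 0) (j - k)
  have hnewton : g n = ∑ j ∈ Finset.range (n + 1), n.choose j • ((Δ_[1])^[j] g) 0 := by
    simpa using shift_eq_sum_fwdDiff_iter 1 g n 0
  rw [hnewton, eval_finsetSum]
  refine Finset.sum_congr_of_eq_on_inter (fun j _ hj ↦ ?_) (fun j _ hj ↦ ?_) (fun j _ _ ↦ ?_)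
  · simp [hvanish j (by simpa using hj)]
  · rw [eval_mul, descPochhammer_eval_eq_descFactorial,
      Nat.descFactorial_of_lt (by simpa using hj), Nat.cast_zero, mul_zero]
  · rw [nsmul_eq_mul, Nat.cast_choose_eq_descPochhammer_div, eval_mul, eval_C]
    ring

theorem eventually_eq_eval_mul_pow_of_mem_maxGenEigenspace {K : Type*} [Field K] [CharZero K]
    {α : K} {f : ℕ → K} (hf : f ∈ (shift K).maxGenEigenspace α) :
    ∃ P : K[X], ∀ᶠ n : ℕ in atTop, f n = P.eval (n : K) * α ^ n := by
  obtain ⟨k, hk⟩ := (Module.End.mem_maxGenEigenspace _ _ _).mp hf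
  rcases eq_or_ne α 0 with rfl | hα
  · refine ⟨0, ?_⟩
    filter_upwards [eventually_ge_atTop k] with n hn
    rw [zero_smul, sub_zero] at hk
    simpa [shift_pow_apply, Nat.sub_add_cancel hn] using congrFun hk (n - k)
  · have hf_eq : f = fun n ↦ α ^ n * (f n / α ^ n) := by
      ext n
      field_simp
    have hdiff : (Δ_[1])^[k] (fun n ↦ f n / α ^ n) = 0 := by
      ext n
      rw [hf_eq] at hk
      have hn := congrFun hk n
      rw [shift_sub_smul_one_pow_apply] at hn
      exact (mul_eq_zero.mp hn).resolve_left (pow_ne_zero _ hα)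
    obtain ⟨P, hP⟩ := exists_eval_natCast_eq_of_fwdDiff_iter_eq_zero hdiff
    exact ⟨P, .of_forall fun n ↦ by rw [← hP, div_mul_cancel₀ _ (pow_ne_zero n hα)]⟩

theorem exists_eventuallyEq_powerSum_of_aeval_shift_eq_zero {K : Type*} [Field K] [CharZero K]
    [DecidableEq K] {p : K[X]} (hp : p.Splits) (hp₀ : p ≠ 0) {f : ℕ → K}
    (hf : aeval (shift K) p f = 0) :
    ∃ P : K → K[X], f =ᶠ[atTop] powerSum (p.roots.toFinset.erase 0) P := by
  obtain ⟨g, hg⟩ := (Submodule.mem_iSup_finset_iff_exists_sum _ _).mp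
    (mem_iSup_maxGenEigenspace_of_aeval_eq_zero hp hp₀ hf)
  choose P hP using fun α ↦ eventually_eq_eval_mul_pow_of_mem_maxGenEigenspace (g α).2
  refine ⟨P, ?_⟩
  filter_upwards [(p.roots.toFinset.eventually_all).mpr fun α _ ↦ hP α,
    eventually_ne_atTop 0] with n hn hn₀
  rw [powerSum, Finset.sum_erase _ (by rw [zero_pow hn₀, mul_zero]), ← hg, Finset.sum_apply]
  exact Finset.sum_congr rfl hn

end Shift

/-! ### Cesàro means -/

section Cesaro

variable {V W 𝕜 : Type*} [NormedAddCommGroup V] [NormedSpace ℝ V] [NormedAddCommGroup W]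
  [NormedSpace ℝ W] [RCLike 𝕜]

/-- The arithmetic means of the first `n` terms of `u` converge to `l` as `n → ∞`. -/
def CesaroTendsto (u : ℕ → V) (l : V) : Prop :=
  Tendsto (fun n : ℕ ↦ (n⁻¹ : ℝ) • ∑ i ∈ Finset.range n, u i) atTop (𝓝 l)

theorem cesaroTendsto_zero : CesaroTendsto (fun _ ↦ 0 : ℕ → V) 0 :=
  tendsto_const_nhds.cesaro_smul

theorem CesaroTendsto.add {u v : ℕ → V} {l m : V} (hu : CesaroTendsto u l)
    (hv : CesaroTendsto v m) : CesaroTendsto (fun n ↦ u n + v n) (l + m) := by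
  simpa only [CesaroTendsto, Finset.sum_add_distrib, smul_add] using Tendsto.add hu hv

theorem CesaroTendsto.sum {ι : Type*} {S : Finset ι} {u : ι → ℕ → V} {l : ι → V}
    (h : ∀ i ∈ S, CesaroTendsto (u i) (l i)) :
    CesaroTendsto (fun n ↦ ∑ i ∈ S, u i n) (∑ i ∈ S, l i) := by
  refine (tendsto_finsetSum S h).congr fun n ↦ ?_
  rw [← Finset.smul_sum, Finset.sum_comm]

theorem CesaroTendsto.map {u : ℕ → V} {l : V} (hu : CesaroTendsto u l) (L : V →L[ℝ] W) :
    CesaroTendsto (fun n ↦ L (u n)) (L l) := by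
  simpa only [CesaroTendsto, Function.comp_def, map_smul, map_sum] using
    (L.continuous.tendsto l).comp hu

theorem CesaroTendsto.congr' {u v : ℕ → V} {l : V} (hu : CesaroTendsto u l)
    (huv : u =ᶠ[atTop] v) : CesaroTendsto v l := by
  have hdiff : CesaroTendsto (fun n ↦ v n - u n) 0 :=
    (tendsto_const_nhds.congr' (huv.mono fun n hn ↦ by rw [hn, sub_self])).cesaro_smul
  simpa using hu.add hdiff

theorem cesaroTendsto_zero_of_norm {v : ℕ → V} (hv : CesaroTendsto (fun n ↦ ‖v n‖) 0) :
    CesaroTendsto v 0 := by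
  refine squeeze_zero_norm (fun n ↦ ?_) hv
  rw [norm_smul, Real.norm_of_nonneg (by positivity), smul_eq_mul]
  gcongr
  exact norm_sum_le _ _

theorem CesaroTendsto.zero_of_nonneg_of_norm_eq {u : ℕ → 𝕜} {v : ℕ → V} (hu : CesaroTendsto u 0)
    (hu₀ : ∀ᶠ n in atTop, 0 ≤ u n) (huv : ∀ n, ‖u n‖ = ‖v n‖) : CesaroTendsto v 0 := by
  have hre : CesaroTendsto (fun n ↦ RCLike.re (u n)) 0 := by simpa using hu.map RCLike.reCLM
  refine cesaroTendsto_zero_of_norm (hre.congr' ?_)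
  filter_upwards [hu₀] with n hn
  simpa [huv] using (congrArg RCLike.re (RCLike.norm_of_nonneg' hn)).symm

theorem cesaroTendsto_pow_of_norm_eq_one {z : 𝕜} (hz : ‖z‖ = 1) (hz₁ : z ≠ 1) :
    CesaroTendsto (fun n ↦ z ^ n) 0 := by
  have hbound : Tendsto (fun n : ℕ ↦ (n⁻¹ : ℝ) * (2 / ‖z - 1‖)) atTop (𝓝 0) := by
    simpa using (tendsto_inv_atTop_nhds_zero_nat (𝕜 := ℝ)).mul_const (2 / ‖z - 1‖)
  refine squeeze_zero_norm (fun n ↦ ?_) hbound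
  rw [norm_smul, Real.norm_of_nonneg (by positivity), geom_sum_eq hz₁, norm_div]
  gcongr
  calc ‖z ^ n - 1‖ ≤ ‖z ^ n‖ + ‖(1 : 𝕜)‖ := norm_sub_le _ _
    _ = 2 := by rw [norm_pow, hz]; norm_num

end Cesaro

/-! ### Growth of generalized power sums -/

section Growth

variable {𝕜 : Type*} [RCLike 𝕜]

theorem tendsto_eval_natCast_div_pow {P : 𝕜[X]} {D : ℕ} (hP : P.natDegree ≤ D) :
    Tendsto (fun n : ℕ ↦ P.eval (n : 𝕜) / (n : 𝕜) ^ D) atTop (𝓝 (P.coeff D)) := by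
  have hreflect : Tendsto (fun n : ℕ ↦ (P.reflect D).eval (n : 𝕜)⁻¹) atTop (𝓝 (P.coeff D)) := by
    have h := ((P.reflect D).continuous.tendsto 0).comp
      (tendsto_inv_atTop_nhds_zero_nat (𝕜 := 𝕜))
    rwa [← coeff_zero_eq_eval_zero, coeff_reflect, revAt_le D.zero_le, Nat.sub_zero] at h
  refine hreflect.congr' ?_
  filter_upwards [eventually_ne_atTop 0] with n hn
  have hn' : (n : 𝕜) ≠ 0 := Nat.cast_ne_zero.mpr hn
  let := invertibleOfNonzero hn'
  rw [eq_div_iff (pow_ne_zero D hn'), ← invOf_eq_inv]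
  exact eval₂_reflect_mul_pow (RingHom.id 𝕜) (n : 𝕜) D P hP

theorem tendsto_eval_natCast_mul_pow (P : 𝕜[X]) {z : 𝕜} (hz : ‖z‖ < 1) :
    Tendsto (fun n : ℕ ↦ P.eval (n : 𝕜) * z ^ n) atTop (𝓝 0) := by
  have hmonomial (i : ℕ) :
      Tendsto (fun n : ℕ ↦ P.coeff i * ((n : 𝕜) ^ i * z ^ n)) atTop (𝓝 0) := by
    simpa using (summable_pow_mul_geometric_of_norm_lt_one i hz).tendsto_atTop_zero.const_mul
      (P.coeff i)
  simpa [eval_eq_sum_range, Finset.sum_mul, mul_assoc] using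
    tendsto_finsetSum (Finset.range (P.natDegree + 1)) fun i _ ↦ hmonomial i

theorem cesaroTendsto_eval_natCast_div_pow_mul_pow {P : 𝕜[X]} {D : ℕ} {z : 𝕜} (hz : ‖z‖ ≤ 1)
    (hP : ‖z‖ = 1 → P.natDegree ≤ D) :
    CesaroTendsto (fun n ↦ P.eval (n : 𝕜) / (n : 𝕜) ^ D * z ^ n)
      (if z = 1 then P.coeff D else 0) := by
  rcases hz.lt_or_eq with hlt | heq
  · have hinv := (tendsto_inv_atTop_nhds_zero_nat (𝕜 := 𝕜)).pow D
    have hlim := (tendsto_eval_natCast_mul_pow P hlt).mul hinv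
    rw [if_neg (by rintro rfl; simp at hlt)]
    rw [zero_mul] at hlim
    refine Tendsto.cesaro_smul (hlim.congr fun n ↦ ?_)
    rw [inv_pow, ← div_eq_mul_inv, mul_div_right_comm]
  have hcoeff := tendsto_eval_natCast_div_pow (hP heq)
  split_ifs with h₁
  · simp only [h₁, one_pow, mul_one]
    exact hcoeff.cesaro_smul
  · have herror : Tendsto (fun n : ℕ ↦ (P.eval (n : 𝕜) / (n : 𝕜) ^ D - P.coeff D) * z ^ n) atTop
        (𝓝 0) := by
      refine tendsto_zero_iff_norm_tendsto_zero.mpr ?_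
      simpa [heq] using tendsto_zero_iff_norm_tendsto_zero.mp (tendsto_sub_nhds_zero_iff.mpr hcoeff)
    have hmain := (cesaroTendsto_pow_of_norm_eq_one heq h₁).map
      (ContinuousLinearMap.mul ℝ 𝕜 (P.coeff D))
    simpa [sub_mul] using CesaroTendsto.add herror.cesaro_smul hmain

theorem cesaroTendsto_powerSum_div {S : Finset 𝕜} {P : 𝕜 → 𝕜[X]} {D : ℕ} {z : 𝕜} (hz : z ≠ 0)
    (hmod : ∀ α ∈ S, P α ≠ 0 → ‖α‖ ≤ ‖z‖) (hdeg : ∀ α ∈ S, ‖α‖ = ‖z‖ → (P α).natDegree ≤ D) :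
    CesaroTendsto (fun n ↦ powerSum S P n / ((n : 𝕜) ^ D * z ^ n))
      (if z ∈ S then (P z).coeff D else 0) := by
  have hz' : 0 < ‖z‖ := norm_pos_iff.mpr hz
  have hterm (α : 𝕜) (hα : α ∈ S) :
      CesaroTendsto (fun n ↦ (P α).eval (n : 𝕜) / (n : 𝕜) ^ D * (α / z) ^ n)
        (if z = α then (P α).coeff D else 0) := by
    by_cases hP : P α = 0
    · simpa [hP] using cesaroTendsto_zero
    have h := cesaroTendsto_eval_natCast_div_pow_mul_pow (P := P α) (D := D) (z := α / z)
      (by rw [norm_div]; exact div_le_one_of_le₀ (hmod α hα hP) hz'.le)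
      (fun h ↦ hdeg α hα (by rwa [norm_div, div_eq_one_iff_eq hz'.ne'] at h))
    simpa only [div_eq_one_iff_eq hz, eq_comm] using h
  have hsum := CesaroTendsto.sum hterm
  simp only [Finset.sum_ite_eq, div_pow, div_mul_div_comm, ← Finset.sum_div] at hsum
  exact hsum

theorem exists_mem_norm_max_natDegree_max {S : Finset 𝕜} {P : 𝕜 → 𝕜[X]}
    (hP : ∃ α ∈ S, P α ≠ 0) :
    ∃ w ∈ S, P w ≠ 0 ∧ (∀ α ∈ S, P α ≠ 0 → ‖α‖ ≤ ‖w‖) ∧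
      ∀ α ∈ S, ‖α‖ = ‖w‖ → (P α).natDegree ≤ (P w).natDegree := by
  classical
  obtain ⟨w, hw, hmax⟩ := (S.filter (P · ≠ 0)).exists_max_image
    (fun α ↦ toLex (‖α‖, (P α).natDegree)) (by simpa [Finset.Nonempty] using hP)
  simp only [Finset.mem_filter, and_imp, Prod.Lex.toLex_le_toLex] at hw hmax
  refine ⟨w, hw.1, hw.2, fun α hα hPα ↦ ?_, fun α hα hnorm ↦ ?_⟩
  · exact (hmax α hα hPα).elim le_of_lt fun h ↦ h.1.le
  · by_cases hPα : P α = 0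
    · simp [hPα]
    · exact (hmax α hα hPα).elim (fun h ↦ absurd hnorm h.ne) And.right

theorem eq_zero_of_eventually_powerSum_eq_zero {S : Finset 𝕜} {P : 𝕜 → 𝕜[X]} (hS : 0 ∉ S)
    (h : ∀ᶠ n in atTop, powerSum S P n = 0) : ∀ α ∈ S, P α = 0 := by
  by_contra! hP
  obtain ⟨w, hwS, hPw, hmod, hdeg⟩ := exists_mem_norm_max_natDegree_max hP
  have hlim := cesaroTendsto_powerSum_div (ne_of_mem_of_not_mem hwS hS) hmod hdeg
  rw [if_pos hwS] at hlim
  have hlim₀ := hlim.congr' (v := fun _ ↦ 0) (h.mono fun n hn ↦ by simp only [hn, zero_div])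
  exact hPw (leadingCoeff_eq_zero.mp (tendsto_nhds_unique hlim₀ cesaroTendsto_zero))

theorem exists_pos_mem_norm_le_of_eventually_powerSum_nonneg {S : Finset 𝕜} {P : 𝕜 → 𝕜[X]}
    (hS : 0 ∉ S) (hP : ∃ α ∈ S, P α ≠ 0) (h : ∀ᶠ n in atTop, 0 ≤ powerSum S P n) :
    ∃ ρ : ℝ, 0 < ρ ∧ (ρ : 𝕜) ∈ S ∧ P ρ ≠ 0 ∧ ∀ α ∈ S, P α ≠ 0 → ‖α‖ ≤ ρ := by
  obtain ⟨w, hwS, hPw, hmod, hdeg⟩ := exists_mem_norm_max_natDegree_max hP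
  have hw : w ≠ 0 := ne_of_mem_of_not_mem hwS hS
  have hρ : ‖(‖w‖ : 𝕜)‖ = ‖w‖ := by simp
  set D := (P w).natDegree
  suffices hcoeff : (if (‖w‖ : 𝕜) ∈ S then (P ‖w‖).coeff D else 0) ≠ 0 by
    obtain ⟨hmem, hne⟩ := ite_ne_right_iff.mp hcoeff
    exact ⟨‖w‖, norm_pos_iff.mpr hw, hmem, fun h₀ ↦ hne (by rw [h₀, coeff_zero]), hmod⟩
  intro hcoeff
  have hmean := cesaroTendsto_powerSum_div (z := (‖w‖ : 𝕜)) (by simpa using hw)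
    (by rwa [hρ]) (by rwa [hρ])
  rw [hcoeff] at hmean
  have hnonneg : ∀ᶠ n : ℕ in atTop, 0 ≤ powerSum S P n / ((n : 𝕜) ^ D * (‖w‖ : 𝕜) ^ n) := by
    filter_upwards [h] with n hn
    have hw₀ : (0 : 𝕜) ≤ ‖w‖ := RCLike.ofReal_nonneg.mpr (norm_nonneg w)
    exact div_nonneg hn (mul_nonneg (pow_nonneg (Nat.cast_nonneg n) D) (pow_nonneg hw₀ n))
  have hmean_zero : CesaroTendsto (fun n : ℕ ↦ powerSum S P n / ((n : 𝕜) ^ D * w ^ n)) 0 :=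
    hmean.zero_of_nonneg_of_norm_eq hnonneg fun n ↦ by simp
  have hmean_coeff := cesaroTendsto_powerSum_div hw hmod hdeg
  rw [if_pos hwS] at hmean_coeff
  exact hPw (leadingCoeff_eq_zero.mp (tendsto_nhds_unique hmean_coeff hmean_zero))

end Growth

/-! ### Signs of real recurrence sequences -/

section Sign

variable {E : LinearRecurrence ℝ} {a : ℕ → ℝ}

theorem exists_isPowerSumRepr (ha : E.IsSolution a) : ∃ P, IsPowerSumRepr E a P := by
  have haeval := aeval_shift_charPoly_algebraMap (A := ℂ) ha
  rw [← aeval_map_algebraMap ℂ] at haeval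
  exact exists_eventuallyEq_powerSum_of_aeval_shift_eq_zero (IsAlgClosed.splits _)
    (E.charPoly_monic.map _).ne_zero haeval

theorem zero_notMem_nonzeroRoots (E : LinearRecurrence ℝ) : 0 ∉ nonzeroRoots E :=
  Finset.notMem_erase _ _

theorem IsPowerSumRepr.mem_charRoots_iff {P : ℂ → ℂ[X]} (hP : IsPowerSumRepr E a P) {α : ℂ} :
    α ∈ charRoots E a ↔ α ∈ nonzeroRoots E ∧ P α ≠ 0 := by
  refine ⟨fun ⟨hα, Q, hQ, hQα⟩ ↦ ⟨hα, ?_⟩, fun ⟨hα, hPα⟩ ↦ ⟨hα, P, hP, hPα⟩⟩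
  have hdiff : ∀ᶠ n in atTop, powerSum (nonzeroRoots E) (fun β ↦ P β - Q β) n = 0 := by
    filter_upwards [hP, hQ] with n hPn hQn
    simp only [powerSum, eval_sub, sub_mul, Finset.sum_sub_distrib, ← hPn, ← hQn, sub_self]
  have hPQ := eq_zero_of_eventually_powerSum_eq_zero (zero_notMem_nonzeroRoots E) hdiff α hα
  rwa [sub_eq_zero.mp hPQ]

theorem IsPowerSumRepr.neg {P : ℂ → ℂ[X]} (hP : IsPowerSumRepr E a P) :
    IsPowerSumRepr E (-a) (-P) := by
  filter_upwards [hP] with n hn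
  simp [hn]

theorem charRoots_neg : charRoots E (-a) = charRoots E a := by
  have hsubset (b : ℕ → ℝ) : charRoots E b ⊆ charRoots E (-b) :=
    fun α ⟨hα, P, hP, hPα⟩ ↦ ⟨hα, -P, hP.neg, neg_ne_zero.mpr hPα⟩
  exact (neg_neg a ▸ hsubset (-a)).antisymm (hsubset a)

theorem dominatingRoots_neg : dominatingRoots E (-a) = dominatingRoots E a := by
  rw [dominatingRoots, charRoots_neg, dominatingRoots]

theorem IsPowerSumRepr.exists_ne_zero {P : ℂ → ℂ[X]} (hP : IsPowerSumRepr E a P)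
    (hne : ∃ᶠ n in atTop, a n ≠ 0) : ∃ α ∈ nonzeroRoots E, P α ≠ 0 := by
  by_contra! hzero
  refine hne ?_
  filter_upwards [hP] with n hn
  rw [Finset.sum_eq_zero fun α hα ↦ by rw [hzero α hα, eval_zero, zero_mul]] at hn
  simpa using hn

theorem exists_pos_mem_dominatingRoots_of_eventually_nonneg (ha : E.IsSolution a)
    (hne : ∃ᶠ n in atTop, a n ≠ 0) (hnonneg : ∀ᶠ n in atTop, 0 ≤ a n) :
    ∃ ρ : ℝ, 0 < ρ ∧ (ρ : ℂ) ∈ dominatingRoots E a := by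
  obtain ⟨P, hP⟩ := exists_isPowerSumRepr ha
  have hsum : ∀ᶠ n in atTop, 0 ≤ powerSum (nonzeroRoots E) P n := by
    filter_upwards [hP, hnonneg] with n hn hn₀
    rw [powerSum, ← hn]
    exact Complex.zero_le_real.mpr hn₀
  obtain ⟨ρ, hρ, hρE, hPρ, hmax⟩ := exists_pos_mem_norm_le_of_eventually_powerSum_nonneg
    (zero_notMem_nonzeroRoots E) (hP.exists_ne_zero hne) hsum
  refine ⟨ρ, hρ, hP.mem_charRoots_iff.mpr ⟨hρE, hPρ⟩, fun β hβ ↦ ?_⟩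
  obtain ⟨hβE, hPβ⟩ := hP.mem_charRoots_iff.mp hβ
  exact (hmax β hβE hPβ).trans_eq (Complex.norm_of_nonneg hρ.le).symm

theorem infinite_setOf_neg (ha : E.IsSolution a) (hne : ∃ᶠ n in atTop, a n ≠ 0)
    (hpos : ∀ α ∈ dominatingRoots E a, ¬ ∃ r : ℝ, 0 < r ∧ α = r) : {n | a n < 0}.Infinite := by
  rw [← Nat.frequently_atTop_iff_infinite]
  by_contra hfin
  obtain ⟨ρ, hρ, hmem⟩ := exists_pos_mem_dominatingRoots_of_eventually_nonneg ha hne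
    ((not_frequently.mp hfin).mono fun n ↦ not_lt.mp)
  exact hpos ρ hmem ⟨ρ, hρ, rfl⟩

end Sign

end RecurrenceSequence

open RecurrenceSequence in
theorem mainTheorem1_general {E : LinearRecurrence ℝ} {a : ℕ → ℝ} (ha : E.IsSolution a)
    (hne : ∃ᶠ n in atTop, a n ≠ 0)
    (hpos : ∀ α ∈ dominatingRoots E a, ¬ ∃ r : ℝ, 0 < r ∧ α = r) :
    {n | 0 < a n}.Infinite ∧ {n | a n < 0}.Infinite := by
  refine ⟨?_, infinite_setOf_neg ha hne hpos⟩
  simpa using infinite_setOf_neg (E.solSpace.neg_mem ha) (by simpa using hne)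
    (by rwa [dominatingRoots_neg])

theorem mainTheorem1 (E : LinearRecurrence ℝ) (a : ℕ → ℝ) (ha : E.IsSolution a)
    (hne : ∃ᶠ n : ℕ in Filter.atTop, a n ≠ 0)
    (hcard : (RecurrenceSequence.dominatingRoots E a).encard ≤ 4)
    (hpos : ∀ α ∈ RecurrenceSequence.dominatingRoots E a, ¬ ∃ r : ℝ, 0 < r ∧ α = (r : ℂ)) :
    {n : ℕ | 0 < a n}.Infinite ∧ {n : ℕ | a n < 0}.Infinite :=
  mainTheorem1_general ha hne hpos
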